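/- Let $(\mathcal X,P_X)$ be an arbitrary probability space (the source $X\sim P_X$), let $\mathcal Y$ be an arbitrary measurable space (the reproduction alphabet), let $d:\mathcal X\times\mathcal Y\to[0,\infty]$ be a measurable distortion function, and let $D\in[0,\infty]$. Let $$R(D)=\inf_{P_{Y|X}:\ \mathbb E[d(X,Y)]\le D} I(X;Y)$$ be Shannon's rate-distortion function, where the infimum is over all Markov kernels $P_{Y|X}$ from $\mathcal X$ to $\mathcal Y$ ($R(D)=\infty$ if there is none with $\mathbb E[d(X,Y)]\le D$), and $I(X;Y)$ is the mutual information in bits, i.e. the relative entropy between the joint law of $(X,Y)$ and the product of its marginals. A one-shot variable-length code has a (possibly stochastic) encoder which, given $X$, selects a reproduction $\tilde Y$ from a countable subset of $\mathcal Y$ and describes it by the codeword $M\in\{0,1\}^*$ assigned to it by an injective code whose set of codewords is prefix-free; the decoder recovers $\tilde Y$ from $M$. A pair $(\bar R,D)$ is achievable if there is such a code with $\mathbb E[L(M)]\le\bar R$ and $\mathbb E[d(X,\tilde Y)]\le D$, where $L(M)$ is the length of $M$. Then every pair $(\bar R,D)$ with $\bar R\in\mathbb R$ and $$\bar R> R(D)+\log_2\bigl(R(D)+1\bigr)+6$$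 is achievable. (If $R(D)=\infty$, no real $\bar R$ satisfies this condition.) -/

import Mathlib

open MeasureTheory ProbabilityTheory InformationTheory
open scoped ENNReal

noncomputable section

/-- The discrete σ-algebra on the set `{0,1}*` of finite binary strings. -/
instance binaryStringsMeasurableSpace : MeasurableSpace (List Bool) := ⊤

instance binaryStringsDiscrete : DiscreteMeasurableSpace (List Bool) :=
  ⟨fun _ => trivial⟩

/-- A set of binary strings is prefix-free if no member is a prefix of a different member. -/
def IsPrefixFree (C : Set (List Bool)) : Prop :=
  ∀ u ∈ C, ∀ v ∈ C, u <+: v → u = v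

/-- Mutual information `I(X;Y)` in bits, for `X ∼ μ` and `Y | X = x ∼ κ x`: the Kullback-Leibler
divergence of the joint law from the product of the marginal laws. Mathlib's `klDiv` is in nats,
whence the division by `log 2`. -/
def mutualInfoBits {𝒳 𝒴 : Type*} [MeasurableSpace 𝒳] [MeasurableSpace 𝒴]
    (μ : Measure 𝒳) (κ : Kernel 𝒳 𝒴) : ℝ≥0∞ :=
  klDiv (μ ⊗ₘ κ) (μ.prod (κ ∘ₘ μ)) / ENNReal.ofReal (Real.log 2)

/-- The average distortion `E[d(X,Y)]` for `X ∼ μ` and `Y | X = x ∼ κ x`. -/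
def avgDistortion {𝒳 𝒴 : Type*} [MeasurableSpace 𝒳] [MeasurableSpace 𝒴]
    (μ : Measure 𝒳) (d : 𝒳 → 𝒴 → ℝ≥0∞) (κ : Kernel 𝒳 𝒴) : ℝ≥0∞ :=
  ∫⁻ p, d p.1 p.2 ∂(μ ⊗ₘ κ)

/-- Shannon's rate-distortion function (in bits): the infimum of `I(X;Y)` over all conditional
laws `P_{Y|X}` (Markov kernels) with `E[d(X,Y)] ≤ D`. It is `∞` if there is no such law. -/
def rateDistortion {𝒳 𝒴 : Type*} [MeasurableSpace 𝒳] [MeasurableSpace 𝒴]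
    (μ : Measure 𝒳) (d : 𝒳 → 𝒴 → ℝ≥0∞) (D : ℝ≥0∞) : ℝ≥0∞ :=
  ⨅ (κ : Kernel 𝒳 𝒴) (_ : IsMarkovKernel κ) (_ : avgDistortion μ d κ ≤ D), mutualInfoBits μ κ

/-- A one-shot variable-length source code with a (possibly stochastic) encoder. Given `X = x`,
the encoder draws a description `M` from the prefix-free set `codebook`; the decoder outputs
`Ỹ = decode M`. As `decode` is injective, `M` is in turn the codeword of `Ỹ`, so that drawing `M`
is the same as selecting a reproduction `Ỹ` and encoding it by a prefix-free code. -/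
structure VariableLengthCode (𝒳 𝒴 : Type*) [MeasurableSpace 𝒳] where
  codebook : Set (List Bool)
  prefixFree : IsPrefixFree codebook
  encoder : Kernel 𝒳 codebook
  isMarkovKernel_encoder : IsMarkovKernel encoder
  decode : codebook → 𝒴
  decode_injective : Function.Injective decode

namespace VariableLengthCode

/-- The expected description length `E[L(M)]` for the source `X ∼ μ`. -/
def expectedLength {𝒳 𝒴 : Type*} [MeasurableSpace 𝒳]
    (c : VariableLengthCode 𝒳 𝒴) (μ : Measure 𝒳) : ℝ≥0∞ :=
  ∫⁻ x, ∫⁻ m, ((m : List Bool).length : ℝ≥0∞) ∂(c.encoder x) ∂μ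

/-- The average distortion `E[d(X,Ỹ)]` of the code for the source `X ∼ μ`. -/
def expectedDistortion {𝒳 𝒴 : Type*} [MeasurableSpace 𝒳]
    (c : VariableLengthCode 𝒳 𝒴) (μ : Measure 𝒳) (d : 𝒳 → 𝒴 → ℝ≥0∞) : ℝ≥0∞ :=
  ∫⁻ x, ∫⁻ m, d x (c.decode m) ∂(c.encoder x) ∂μ

end VariableLengthCode

/-- The expected length-distortion pair `(R, D)` is achievable for the source `X ∼ μ` and the
distortion measure `d`. -/
def IsAchievable {𝒳 𝒴 : Type*} [MeasurableSpace 𝒳]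
    (μ : Measure 𝒳) (d : 𝒳 → 𝒴 → ℝ≥0∞) (R : ℝ) (D : ℝ≥0∞) : Prop :=
  ∃ c : VariableLengthCode 𝒳 𝒴,
    c.expectedLength μ ≤ ENNReal.ofReal R ∧ c.expectedDistortion μ d ≤ D

end

/-!
A test channel `κ` with mutual information `I` bits is simulated by *greedy rejection sampling*. Let
`Q` be the law of `Y` under `κ`, let `f x` be the density of the law of `Y` given `X = x` with
respect to `Q`, and draw a codebook `z 0, z 1, …` independently from `Q`. Step `n` accepts `z n` with
the largest probability that does not make the law of the output exceed `f x`: the density covered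
so far is `min (f x) S` for a level `S` that depends on `x` and `n` (`coverLevel`), the total mass
`s` left (`residualMass`) is the probability of getting to step `n`, and `S` is raised by `s`.
Averaged over the codebook, the first accepted sample has exactly the density `f x`
(`lintegral_selectProb_mul`).

Since `s` decreases, `(n + 1) s ≤ S + s`, so that for `n ≥ 1`
`log (n + 1) ≤ log (S / s + 1) ≤ log S + log (1 + 1 / s)`. Averaging over the accepted step `n`, the
first term is a lower Riemann sum of `∫ log`, bounded by the relative entropy
`∫ (f log f - f + 1) dQ`, and the second one is a lower Riemann sum of
`∫₀¹ log (1 + 1 / s) ds = 2 log 2`. Hence `𝔼 log₂ (n + 1) ≤ I + 2`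
(`tsum_lintegral_coverPart_mul_log_le`).

The index `n` is described by a prefix-free code of length at most
`log₂ (n + 1) (1 + 2⁻ʳ) + r + 1` (`golombCode`). With `r = ⌊log₂ (I + 2)⌋` the mean length is at most
`(I + 2) + log₂ (I + 2) + 2 ≤ I + log₂ (I + 1) + 5`. A code has no codebook at random, but the mean
over the codebooks of the pair of length and distortion is dominated by a mixture of two of its
values (`exists_mixture_le`; the bound on the length is strict), and one more bit tells which of the
two codebooks is in use. Finally, a decoder that maps several codewords to the same reproduction is
made injective by keeping the shortest of them (`isAchievable_of_weights`).
-/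

/-! ### A universal prefix-free code for the natural numbers -/

/-- The binary digits of `v` at the positions `0, …, n - 1`. -/
def binaryDigits (n v : ℕ) : List Bool := List.ofFn fun i : Fin n ↦ v.testBit i

@[simp]
lemma length_binaryDigits (n v : ℕ) : (binaryDigits n v).length = n := by
  simp [binaryDigits]

lemma binaryDigits_inj {n u v : ℕ} (hu : u < 2 ^ n) (hv : v < 2 ^ n)
    (h : binaryDigits n u = binaryDigits n v) : u = v := by
  have h' := List.ofFn_injective h
  refine Nat.eq_of_testBit_eq fun i ↦ ?_
  by_cases hi : i < n
  · exact congrFun h' ⟨i, hi⟩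
  · have hn : 2 ^ n ≤ 2 ^ i := Nat.pow_le_pow_right two_pos (not_lt.1 hi)
    rw [Nat.testBit_lt_two_pow (hu.trans_le hn), Nat.testBit_lt_two_pow (hv.trans_le hn)]

/-- A prefix-free code for the index `k`. With `a = ⌊log₂ (k + 1)⌋`, the number `a` is described by
its Golomb-Rice code with parameter `2 ^ r` (the quotient `a / 2 ^ r` in unary, then the remainder
in `r` binary digits), and is followed by the `a` digits of `k + 1` below the leading one. -/
def golombCode (r k : ℕ) : List Bool :=
  List.replicate (Nat.log 2 (k + 1) / 2 ^ r) true ++ false ::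
    (binaryDigits r (Nat.log 2 (k + 1) % 2 ^ r) ++
      binaryDigits (Nat.log 2 (k + 1)) (k + 1 - 2 ^ Nat.log 2 (k + 1)))

lemma length_golombCode (r k : ℕ) :
    (golombCode r k).length = Nat.log 2 (k + 1) / 2 ^ r + 1 + r + Nat.log 2 (k + 1) := by
  simp [golombCode]
  omega

lemma eq_and_prefix_of_unary_prefix {q q' : ℕ} {u v : List Bool}
    (h : List.replicate q true ++ false :: u <+: List.replicate q' true ++ false :: v) :
    q = q' ∧ u <+: v := by
  induction q generalizing q' with
  | zero =>
    cases q' with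
    | zero => simpa using h
    | succ n => simp [List.replicate_succ] at h
  | succ n ih =>
    cases q' with
    | zero => simp [List.replicate_succ] at h
    | succ m =>
      simp only [List.replicate_succ, List.cons_append, List.cons_prefix_cons, true_and] at h
      simpa using ih h

lemma eq_and_prefix_of_append_prefix {a a' u v : List Bool} (hl : a.length = a'.length)
    (h : a ++ u <+: a' ++ v) : a = a' ∧ u <+: v := by
  obtain ⟨t, ht⟩ := h
  rw [List.append_assoc] at ht
  obtain ⟨h1, h2⟩ := List.append_inj ht hl
  exact ⟨h1, t, h2⟩

lemma golombCode_prefix {r k l : ℕ} (h : golombCode r k <+: golombCode r l) : k = l := by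
  obtain ⟨hq, h⟩ := eq_and_prefix_of_unary_prefix h
  obtain ⟨hm, h⟩ := eq_and_prefix_of_append_prefix (by simp) h
  have hpos : 0 < 2 ^ r := by positivity
  have ha : Nat.log 2 (k + 1) = Nat.log 2 (l + 1) := by
    rw [← Nat.div_add_mod (Nat.log 2 (k + 1)) (2 ^ r), hq,
      binaryDigits_inj (Nat.mod_lt _ hpos) (Nat.mod_lt _ hpos) hm, Nat.div_add_mod]
  have hk := Nat.pow_log_le_self 2 (Nat.succ_ne_zero k)
  have hl := Nat.pow_log_le_self 2 (Nat.succ_ne_zero l)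
  have hk' := Nat.lt_pow_succ_log_self one_lt_two (k + 1)
  have hl' := Nat.lt_pow_succ_log_self one_lt_two (l + 1)
  simp only [Nat.succ_eq_add_one, pow_succ] at hk hl hk' hl'
  rw [ha] at h hk hk'
  have := binaryDigits_inj (by omega) (by omega) (h.eq_of_length (by simp))
  omega

/-! ### Codes from random choices of an index -/

/-- It suffices to describe an index `i` of a reproduction `dec i` by a prefix-free code `e`: an
index may be replaced by the one with the shortest description among all those of the same
reproduction, which makes the decoder injective. -/
theorem isAchievable_of_weights {𝒳 𝒴 ι : Type*} [MeasurableSpace 𝒳] [MeasurableSpace 𝒴]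
    [Countable ι] {μ : Measure 𝒳} {d : 𝒳 → 𝒴 → ℝ≥0∞} {R : ℝ} {D : ℝ≥0∞}
    (e : ι → List Bool) (he : ∀ i j, e i <+: e j → i = j) (dec : ι → 𝒴)
    (w : 𝒳 → ι → ℝ≥0∞) (hw : ∀ i, Measurable fun x ↦ w x i) (hw1 : ∀ x, ∑' i, w x i = 1)
    (hL : ∫⁻ x, ∑' i, w x i * ((e i).length : ℝ≥0∞) ∂μ ≤ ENNReal.ofReal R)
    (hD : ∫⁻ x, ∑' i, w x i * d x (dec i) ∂μ ≤ D) : IsAchievable μ d R D := by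
  have hmin : ∀ y : Set.range dec, ∃ i, dec i = y ∧
      ∀ j, dec j = y → (e i).length ≤ (e j).length := by
    rintro ⟨_, i, rfl⟩
    obtain ⟨j, hj, hmin⟩ := (measure fun i ↦ (e i).length).wf.has_min {j | dec j = dec i} ⟨i, rfl⟩
    exact ⟨j, hj, fun k hk ↦ not_lt.1 (hmin k hk)⟩
  choose g hg hgmin using hmin
  let can : ι → ι := fun i ↦ g ⟨dec i, i, rfl⟩
  have hcan : ∀ i, dec (can i) = dec i := fun i ↦ hg ⟨dec i, i, rfl⟩
  have hinj : ∀ i j, dec (can i) = dec (can j) → can i = can j := by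
    intro i j h
    rw [hcan, hcan] at h
    simp only [can]
    congr 2
  let C : Set (List Bool) := Set.range fun i ↦ e (can i)
  let cw : ι → C := fun i ↦ ⟨e (can i), i, rfl⟩
  let decode : C → 𝒴 := fun m ↦ dec m.2.choose
  have hcw : ∀ m : C, cw m.2.choose = m := fun m ↦ Subtype.ext m.2.choose_spec
  have hdec : ∀ i, decode (cw i) = dec i := by
    intro i
    have h : e (can (cw i).2.choose) = e (can i) := (cw i).2.choose_spec
    have h' := he (can (cw i).2.choose) (can i) (by rw [h])
    exact (hcan _).symm.trans ((congrArg dec h').trans (hcan i))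
  let κ : Kernel 𝒳 C :=
    { toFun := fun x ↦ Measure.sum fun i ↦ w x i • Measure.dirac (cw i)
      measurable' := by
        refine Measure.measurable_of_measurable_coe _ fun s hs ↦ ?_
        simp only [Measure.sum_apply _ hs, Measure.smul_apply, smul_eq_mul]
        exact Measurable.tsum fun i ↦ (hw i).mul_const _ }
  have hκ : ∀ x (f : C → ℝ≥0∞), ∫⁻ m, f m ∂(κ x) = ∑' i, w x i * f (cw i) := by
    intro x f
    change ∫⁻ m, f m ∂(Measure.sum fun i ↦ w x i • Measure.dirac (cw i)) = _
    simp [lintegral_sum_measure, lintegral_smul_measure]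
  refine ⟨⟨C, ?_, κ, ⟨fun x ↦ ⟨?_⟩⟩, decode, ?_⟩, ?_, ?_⟩
  · rintro _ ⟨i, rfl⟩ _ ⟨j, rfl⟩ h
    exact congrArg e (he _ _ h)
  · simpa [hw1] using hκ x 1
  · intro m m' h
    rw [← hcw m, ← hcw m', hdec, hdec, ← hcan, ← hcan m'.2.choose] at h
    rw [← hcw m, ← hcw m']
    exact Subtype.ext (congrArg e (hinj _ _ h))
  · refine le_trans (lintegral_mono fun x ↦ ?_) hL
    rw [hκ]
    gcongr with i
    exact hgmin ⟨dec i, i, rfl⟩ i rfl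
  · refine le_trans (le_of_eq (lintegral_congr fun x ↦ ?_)) hD
    simp only [hκ, hdec]

/-! ### Greedy covering of a density -/

section Greedy

variable {𝒴 : Type*} [MeasurableSpace 𝒴]

/-- The level `S n` up to which the greedy procedure has covered the density `f` after `n` steps:
in each step it is raised by the mass `1 - ∫ min f (S n) dQ` that is not covered yet. -/
noncomputable def coverLevel (Q : Measure 𝒴) (f : 𝒴 → ℝ≥0∞) : ℕ → ℝ≥0∞
  | 0 => 0
  | n + 1 => coverLevel Q f n + (1 - ∫⁻ y, min (f y) (coverLevel Q f n) ∂Q)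

/-- The mass of `f` that is not covered after `n` steps. -/
noncomputable def residualMass (Q : Measure 𝒴) (f : 𝒴 → ℝ≥0∞) (n : ℕ) : ℝ≥0∞ :=
  1 - ∫⁻ y, min (f y) (coverLevel Q f n) ∂Q

/-- The part of the density `f` that is covered in step `n`. -/
noncomputable def coverPart (Q : Measure 𝒴) (f : 𝒴 → ℝ≥0∞) (n : ℕ) (y : 𝒴) : ℝ≥0∞ :=
  min (f y) (coverLevel Q f (n + 1)) - min (f y) (coverLevel Q f n)

variable {Q : Measure 𝒴} {f : 𝒴 → ℝ≥0∞}

lemma coverLevel_succ (n : ℕ) :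
    coverLevel Q f (n + 1) = coverLevel Q f n + residualMass Q f n := rfl

lemma coverLevel_mono : Monotone (coverLevel Q f) :=
  monotone_nat_of_le_succ fun n ↦ by rw [coverLevel_succ]; exact le_self_add

lemma residualMass_anti : Antitone (residualMass Q f) := fun m n h ↦ by
  unfold residualMass
  gcongr
  exact coverLevel_mono h

lemma residualMass_le_one (n : ℕ) : residualMass Q f n ≤ 1 := tsub_le_self

lemma residualMass_ne_top (n : ℕ) : residualMass Q f n ≠ ∞ :=
  ne_top_of_le_ne_top ENNReal.one_ne_top (residualMass_le_one n)

lemma residualMass_zero : residualMass Q f 0 = 1 := by simp [residualMass, coverLevel]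

lemma coverLevel_one : coverLevel Q f 1 = 1 := by simp [coverLevel]

lemma coverLevel_ne_top (n : ℕ) : coverLevel Q f n ≠ ∞ := by
  induction n with
  | zero => simp [coverLevel]
  | succ n ih =>
    rw [coverLevel_succ]
    exact ENNReal.add_ne_top.2 ⟨ih, residualMass_ne_top n⟩

lemma coverPart_le_residualMass (n : ℕ) (y : 𝒴) : coverPart Q f n y ≤ residualMass Q f n := by
  rw [coverPart, tsub_le_iff_right, coverLevel_succ]
  rcases le_total (f y) (coverLevel Q f n) with h | h
  · rw [min_eq_left h]
    exact (min_le_left _ _).trans le_add_self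
  · rw [min_eq_right h, add_comm]
    exact min_le_right _ _

lemma min_add_coverPart (n : ℕ) (y : 𝒴) :
    min (f y) (coverLevel Q f n) + coverPart Q f n y = min (f y) (coverLevel Q f (n + 1)) :=
  add_tsub_cancel_of_le (min_le_min le_rfl (coverLevel_mono n.le_succ))

lemma sum_coverPart (n : ℕ) (y : 𝒴) :
    ∑ i ∈ Finset.range n, coverPart Q f i y = min (f y) (coverLevel Q f n) := by
  induction n with
  | zero => simp [coverLevel]
  | succ n ih => rw [Finset.sum_range_succ, ih, min_add_coverPart]

lemma tsum_coverPart_le (y : 𝒴) : ∑' i, coverPart Q f i y ≤ f y :=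
  ENNReal.tsum_le_of_sum_range_le fun n ↦ (sum_coverPart n y).trans_le (min_le_left _ _)

lemma measurable_coverPart (hf : Measurable f) (n : ℕ) : Measurable (coverPart Q f n) := by
  unfold coverPart
  fun_prop

section Mass

variable (hf : Measurable f) (hf1 : ∫⁻ y, f y ∂Q = 1)
include hf hf1

lemma residualMass_succ_add (n : ℕ) :
    residualMass Q f (n + 1) + ∫⁻ y, coverPart Q f n y ∂Q = residualMass Q f n := by
  have hle : ∀ n, ∫⁻ y, min (f y) (coverLevel Q f n) ∂Q ≤ 1 := fun n ↦
    (lintegral_mono fun y ↦ min_le_left _ _).trans hf1.le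
  have h : ∫⁻ y, min (f y) (coverLevel Q f n) ∂Q + ∫⁻ y, coverPart Q f n y ∂Q =
      ∫⁻ y, min (f y) (coverLevel Q f (n + 1)) ∂Q := by
    rw [← lintegral_add_left (by fun_prop)]
    exact lintegral_congr fun y ↦ min_add_coverPart n y
  have h0 := ne_top_of_le_ne_top ENNReal.one_ne_top (hle n)
  refine (ENNReal.add_right_inj h0).1 ?_
  rw [residualMass, residualMass, add_tsub_cancel_of_le (hle n), add_left_comm, h,
    tsub_add_cancel_of_le (hle (n + 1))]

lemma tsum_lintegral_coverPart : ∑' n, ∫⁻ y, coverPart Q f n y ∂Q = 1 := by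
  have hle : ∑' n, ∫⁻ y, coverPart Q f n y ∂Q ≤ 1 := by
    rw [← lintegral_tsum fun n ↦ (measurable_coverPart hf n).aemeasurable]
    exact (lintegral_mono fun y ↦ tsum_coverPart_le y).trans hf1.le
  refine hle.antisymm ?_
  by_contra! hlt
  set A := ∑' n, ∫⁻ y, coverPart Q f n y ∂Q with hA
  have hcov : ∀ n, ∫⁻ y, min (f y) (coverLevel Q f n) ∂Q ≤ A := by
    intro n
    calc ∫⁻ y, min (f y) (coverLevel Q f n) ∂Q
        = ∑ i ∈ Finset.range n, ∫⁻ y, coverPart Q f i y ∂Q := by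
          rw [← lintegral_finsetSum _ fun i _ ↦ measurable_coverPart hf i]
          exact lintegral_congr fun y ↦ (sum_coverPart n y).symm
      _ ≤ A := ENNReal.sum_le_tsum _
  -- A residual mass of at least `1 - A > 0` would raise the level beyond every bound.
  have hlev : ∀ n : ℕ, n * (1 - A) ≤ coverLevel Q f n := by
    intro n
    induction n with
    | zero => simp
    | succ n ih =>
      rw [coverLevel_succ, Nat.cast_succ, add_mul, one_mul]
      exact add_le_add ih (tsub_le_tsub_left (hcov n) 1)
  have hsup : ∀ y, ⨆ n : ℕ, min (f y) (n * (1 - A)) = f y := by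
    intro y
    have : ⨆ n : ℕ, (n : ℝ≥0∞) * (1 - A) = ∞ := by
      rw [← ENNReal.iSup_mul, ENNReal.iSup_natCast, ENNReal.top_mul (tsub_pos_of_lt hlt).ne']
    change ⨆ n : ℕ, f y ⊓ _ = _
    rw [← inf_iSup_eq, this, inf_top_eq]
  have : ∫⁻ y, f y ∂Q ≤ A := by
    calc ∫⁻ y, f y ∂Q = ∫⁻ y, ⨆ n : ℕ, min (f y) (n * (1 - A)) ∂Q := by simp_rw [hsup]
      _ = ⨆ n : ℕ, ∫⁻ y, min (f y) (n * (1 - A)) ∂Q := by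
          refine lintegral_iSup (fun n ↦ by fun_prop) fun m n h y ↦ ?_
          dsimp only
          gcongr
      _ ≤ A := iSup_le fun n ↦
          (lintegral_mono fun y ↦ min_le_min le_rfl (hlev n)).trans (hcov n)
  exact absurd (hf1.symm.trans_le this) (not_le.2 hlt)

end Mass

/-! ### The number of steps of the greedy procedure -/

lemma mul_residualMass_le_coverLevel (n : ℕ) : n * residualMass Q f n ≤ coverLevel Q f n := by
  induction n with
  | zero => simp
  | succ n ih =>
    rw [coverLevel_succ, Nat.cast_succ, add_mul, one_mul]
    have := residualMass_anti (Q := Q) (f := f) n.le_succ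
    exact add_le_add ((mul_le_mul_right this _).trans ih) this

/-- A step `n ≥ 1` in which mass is left satisfies `(n + 1) s ≤ S + s` for the level `S ≥ 1` and
the residual mass `s`, whence `log (n + 1) ≤ log (S / s + 1) ≤ log S + log (1 + 1 / s)`. -/
lemma coverPart_mul_log_le (n : ℕ) (y : 𝒴) :
    coverPart Q f n y * ENNReal.ofReal (Real.log (n + 1)) ≤
      coverPart Q f n y * ENNReal.ofReal (Real.log (coverLevel Q f n).toReal) +
      coverPart Q f n y * ENNReal.ofReal (Real.log (1 + 1 / (residualMass Q f n).toReal)) := by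
  rcases Nat.eq_zero_or_pos n with rfl | hn
  · simp
  rcases eq_or_ne (residualMass Q f n) 0 with h0 | h0
  · have : coverPart Q f n y = 0 := le_antisymm ((coverPart_le_residualMass n y).trans_eq h0) bot_le
    simp [this]
  rw [← mul_add]
  gcongr
  have ha : 0 < (residualMass Q f n).toReal := ENNReal.toReal_pos h0 (residualMass_ne_top n)
  have hL : 1 ≤ (coverLevel Q f n).toReal := by
    rw [← ENNReal.toReal_one, ← coverLevel_one (Q := Q) (f := f)]
    exact ENNReal.toReal_mono (coverLevel_ne_top n) (coverLevel_mono hn)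
  have hmul : n * (residualMass Q f n).toReal ≤ (coverLevel Q f n).toReal := by
    simpa using ENNReal.toReal_mono (coverLevel_ne_top n)
      (mul_residualMass_le_coverLevel (Q := Q) (f := f) n)
  set a := (residualMass Q f n).toReal
  set L := (coverLevel Q f n).toReal
  have h1 : 1 ≤ 1 + 1 / a := by simp [ha.le]
  rw [← ENNReal.ofReal_add (Real.log_nonneg hL) (Real.log_nonneg h1),
    ← Real.log_mul (by positivity) (by positivity)]
  refine ENNReal.ofReal_le_ofReal (Real.log_le_log (by positivity) ?_)
  rw [← le_div_iff₀ ha] at hmul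
  rw [mul_add, mul_one, mul_one_div]
  linarith

lemma sub_mul_log_le_klFun_sub {a b : ℝ} (ha : 0 < a) (hb : 0 < b) :
    (b - a) * Real.log a ≤ klFun b - klFun a := by
  have h := Real.log_le_sub_one_of_pos (div_pos ha hb)
  rw [Real.log_div ha.ne' hb.ne'] at h
  have h' := mul_le_mul_of_nonneg_left h hb.le
  have : b * (a / b - 1) = a - b := by field_simp
  rw [this] at h'
  simp only [klFun_apply]
  linarith

/-- As `klFun' = log`, the sum is a lower Riemann sum of `∫ log` between `1` and `f y`. -/
lemma sum_coverPart_mul_log_coverLevel_le {y : 𝒴} (hy : f y ≠ ∞) (n : ℕ) :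
    ∑ i ∈ Finset.range n, coverPart Q f i y * ENNReal.ofReal (Real.log (coverLevel Q f i).toReal) ≤
      ENNReal.ofReal (klFun (f y).toReal) := by
  have hL : ∀ i, 1 ≤ (coverLevel Q f (i + 1)).toReal := fun i ↦ by
    rw [← ENNReal.toReal_one, ← coverLevel_one (Q := Q) (f := f)]
    exact ENNReal.toReal_mono (coverLevel_ne_top _) (coverLevel_mono (by omega))
  have hlog : ∀ i, 0 ≤ Real.log (coverLevel Q f i).toReal := by
    rintro (_ | i)
    · simp [coverLevel]
    · exact Real.log_nonneg (hL i)
  have hv : ∀ i, (min (f y) (coverLevel Q f i)).toReal =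
      min (f y).toReal (coverLevel Q f i).toReal := fun i ↦
    ENNReal.toReal_min hy (coverLevel_ne_top i)
  have hmono : ∀ i, (coverLevel Q f i).toReal ≤ (coverLevel Q f (i + 1)).toReal := fun i ↦
    ENNReal.toReal_mono (coverLevel_ne_top _) (coverLevel_mono i.le_succ)
  have hterm : ∀ i, coverPart Q f i y * ENNReal.ofReal (Real.log (coverLevel Q f i).toReal) =
      ENNReal.ofReal ((min (f y).toReal (coverLevel Q f (i + 1)).toReal -
        min (f y).toReal (coverLevel Q f i).toReal) * Real.log (coverLevel Q f i).toReal) := by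
    intro i
    rw [ENNReal.ofReal_mul (sub_nonneg.2 (min_le_min le_rfl (hmono i))), ← hv, ← hv, coverPart,
      ENNReal.ofReal_sub _ ENNReal.toReal_nonneg, ENNReal.ofReal_toReal, ENNReal.ofReal_toReal]
    · exact ne_top_of_le_ne_top hy (min_le_left _ _)
    · exact ne_top_of_le_ne_top hy (min_le_left _ _)
  simp_rw [hterm]
  rw [← ENNReal.ofReal_sum_of_nonneg fun i _ ↦
    mul_nonneg (sub_nonneg.2 (min_le_min le_rfl (hmono i))) (hlog i)]
  refine ENNReal.ofReal_le_ofReal ?_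
  have hf0 : 0 ≤ (f y).toReal := ENNReal.toReal_nonneg
  set F := (f y).toReal
  have key : ∀ n, ∑ i ∈ Finset.range n, (min F (coverLevel Q f (i + 1)).toReal -
      min F (coverLevel Q f i).toReal) * Real.log (coverLevel Q f i).toReal ≤
      klFun (max 1 (min F (coverLevel Q f n).toReal)) := by
    intro n
    induction n with
    | zero => simp [coverLevel, klFun_one, hf0]
    | succ n ih =>
      rw [Finset.sum_range_succ]
      rcases n with _ | n
      · simpa [coverLevel] using klFun_nonneg (by positivity)
      rcases le_total F (coverLevel Q f (n + 1)).toReal with h | h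
      · rw [min_eq_left h, min_eq_left (h.trans (hmono _)), sub_self, zero_mul, add_zero]
        rwa [min_eq_left h] at ih
      · have h1 := hL n
        have h2 : (coverLevel Q f (n + 1)).toReal ≤ min F (coverLevel Q f (n + 1 + 1)).toReal :=
          le_min h (hmono _)
        rw [min_eq_right h, max_eq_right h1] at ih
        rw [min_eq_right h, max_eq_right (h1.trans h2)]
        have := sub_mul_log_le_klFun_sub (a := (coverLevel Q f (n + 1)).toReal)
          (b := min F (coverLevel Q f (n + 1 + 1)).toReal) (by linarith) (by linarith)
        linarith
  refine (key n).trans ?_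
  rcases le_total (min F (coverLevel Q f n).toReal) 1 with h | h
  · rw [max_eq_left h, klFun_one]
    exact klFun_nonneg hf0
  · rw [max_eq_right h]
    have hF : min F (coverLevel Q f n).toReal ≤ F := min_le_left _ _
    have := sub_mul_log_le_klFun_sub (a := min F (coverLevel Q f n).toReal) (b := F)
      (by linarith) (by linarith)
    have := mul_nonneg (sub_nonneg.2 hF) (Real.log_nonneg h)
    linarith

/-- The antiderivative `(1 + s) log (1 + s) - s log s` of `log (1 + 1 / s)` is concave. -/
lemma sub_mul_log_one_add_inv_le {a b : ℝ} (hb : 0 ≤ b) (hba : b ≤ a) :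
    (a - b) * Real.log (1 + 1 / a) ≤ ((1 + a) * Real.log (1 + a) - a * Real.log a) -
      ((1 + b) * Real.log (1 + b) - b * Real.log b) := by
  rcases hb.eq_or_lt with rfl | hb
  · rcases hba.eq_or_lt with rfl | ha
    · simp
    · have : 1 + 1 / a = (1 + a) / a := by field_simp; ring
      rw [this, Real.log_div (by positivity) ha.ne']
      have := Real.log_nonneg (by linarith : 1 ≤ 1 + a)
      simp only [add_zero, Real.log_one, zero_mul, mul_zero, sub_zero]
      linarith
  · have ha : 0 < a := hb.trans_le hba
    have : 1 + 1 / a = (1 + a) / a := by field_simp; ring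
    rw [this, Real.log_div (by positivity) ha.ne']
    have h1 := Real.log_le_sub_one_of_pos (x := a * (1 + b) / (b * (1 + a))) (by positivity)
    have h2 := Real.log_le_sub_one_of_pos (x := (1 + b) / (1 + a)) (by positivity)
    rw [Real.log_div (by positivity) (by positivity), Real.log_mul (by positivity) (by positivity),
      Real.log_mul (by positivity) (by positivity)] at h1
    rw [Real.log_div (by positivity) (by positivity)] at h2
    have h1' := mul_le_mul_of_nonneg_left h1 hb.le
    have h3 : b * (a * (1 + b) / (b * (1 + a)) - 1) + ((1 + b) / (1 + a) - 1) = 0 := by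
      field_simp
      ring
    linarith

lemma sum_coverMass_mul_log_le (hf : Measurable f) (hf1 : ∫⁻ y, f y ∂Q = 1) (n : ℕ) :
    ∑ i ∈ Finset.range n, (∫⁻ y, coverPart Q f i y ∂Q) *
        ENNReal.ofReal (Real.log (1 + 1 / (residualMass Q f i).toReal)) ≤
      ENNReal.ofReal (2 * Real.log 2) := by
  set a : ℕ → ℝ := fun i ↦ (residualMass Q f i).toReal with ha_def
  have ha : ∀ i, 0 ≤ a i := fun i ↦ ENNReal.toReal_nonneg
  have hanti : ∀ i, a (i + 1) ≤ a i := fun i ↦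
    ENNReal.toReal_mono (residualMass_ne_top _) (residualMass_anti i.le_succ)
  have hlog : ∀ i, 0 ≤ Real.log (1 + 1 / a i) := fun i ↦
    Real.log_nonneg (by simp [ha i])
  have hterm : ∀ i, (∫⁻ y, coverPart Q f i y ∂Q) * ENNReal.ofReal (Real.log (1 + 1 / a i)) =
      ENNReal.ofReal ((a i - a (i + 1)) * Real.log (1 + 1 / a i)) := by
    intro i
    rw [ENNReal.ofReal_mul (sub_nonneg.2 (hanti i)), ENNReal.ofReal_sub _ (ha _),
      ENNReal.ofReal_toReal (residualMass_ne_top _), ENNReal.ofReal_toReal (residualMass_ne_top _),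
      ← residualMass_succ_add hf hf1 i, ENNReal.add_sub_cancel_left (residualMass_ne_top _)]
  rw [Finset.sum_congr rfl fun i _ ↦ hterm i, ← ENNReal.ofReal_sum_of_nonneg fun i _ ↦
    mul_nonneg (sub_nonneg.2 (hanti i)) (hlog i)]
  refine ENNReal.ofReal_le_ofReal ?_
  have h := Finset.sum_le_sum fun i (_ : i ∈ Finset.range n) ↦
    sub_mul_log_one_add_inv_le (ha (i + 1)) (hanti i)
  rw [Finset.sum_range_sub' fun i ↦ (1 + a i) * Real.log (1 + a i) - a i * Real.log (a i)] at h
  have h0 : a 0 = 1 := by simp [ha_def, residualMass_zero]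
  have h1 : a n ≤ 1 := by
    simpa [ha_def] using ENNReal.toReal_mono ENNReal.one_ne_top
      (residualMass_le_one (Q := Q) (f := f) n)
  have h2 : a n * Real.log (a n) ≤ 0 :=
    mul_nonpos_of_nonneg_of_nonpos (ha n) (Real.log_nonpos (ha n) h1)
  have h3 : 0 ≤ (1 + a n) * Real.log (1 + a n) :=
    mul_nonneg (by linarith [ha n]) (Real.log_nonneg (by linarith [ha n]))
  rw [h0] at h
  simp only [Real.log_one, mul_zero, sub_zero, one_add_one_eq_two] at h
  linarith

/-- The step `n + 1` in which a point is covered satisfies `𝔼 log (n + 1) ≤ D + 2 log 2`, where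
`D = ∫ klFun f dQ` is the relative entropy of the law with density `f`. -/
theorem tsum_lintegral_coverPart_mul_log_le (hf : Measurable f) (hf1 : ∫⁻ y, f y ∂Q = 1) :
    ∑' n, (∫⁻ y, coverPart Q f n y ∂Q) * ENNReal.ofReal (Real.log (n + 1)) ≤
      ∫⁻ y, ENNReal.ofReal (klFun (f y).toReal) ∂Q + ENNReal.ofReal (2 * Real.log 2) := by
  refine ENNReal.tsum_le_of_sum_range_le fun n ↦ ?_
  have hfin : ∀ᵐ y ∂Q, f y ≠ ∞ :=
    (ae_lt_top hf (hf1.trans_ne ENNReal.one_ne_top)).mono fun y h ↦ h.ne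
  have hm := measurable_coverPart (Q := Q) hf
  calc ∑ i ∈ Finset.range n, (∫⁻ y, coverPart Q f i y ∂Q) * ENNReal.ofReal (Real.log (i + 1))
      ≤ ∑ i ∈ Finset.range n, (∫⁻ y, coverPart Q f i y *
            ENNReal.ofReal (Real.log (coverLevel Q f i).toReal) ∂Q +
          (∫⁻ y, coverPart Q f i y ∂Q) *
            ENNReal.ofReal (Real.log (1 + 1 / (residualMass Q f i).toReal))) := by
        refine Finset.sum_le_sum fun i _ ↦ ?_
        rw [← lintegral_mul_const _ (hm i), ← lintegral_mul_const _ (hm i),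
          ← lintegral_add_left ((hm i).mul_const _)]
        exact lintegral_mono fun y ↦ coverPart_mul_log_le i y
    _ ≤ _ := by
        rw [Finset.sum_add_distrib, ← lintegral_finsetSum _ fun i _ ↦ (hm i).mul_const _]
        refine add_le_add (lintegral_mono_ae ?_) (sum_coverMass_mul_log_le hf hf1 n)
        filter_upwards [hfin] with y hy using sum_coverPart_mul_log_coverLevel_le hy n

end Greedy

/-! ### Greedy rejection sampling from a random codebook -/

section Sampling

variable {𝒴 : Type*} [MeasurableSpace 𝒴]

/-- The probability with which step `n` of greedy rejection sampling accepts the sample `y`. -/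
noncomputable def acceptProb (Q : Measure 𝒴) (f : 𝒴 → ℝ≥0∞) (n : ℕ) (y : 𝒴) : ℝ≥0∞ :=
  coverPart Q f n y / residualMass Q f n

/-- The probability that the first accepted sample of the sequence `z` is `z n`. -/
noncomputable def firstAcceptProb (Q : Measure 𝒴) (f : 𝒴 → ℝ≥0∞) (n : ℕ) (z : ℕ → 𝒴) : ℝ≥0∞ :=
  acceptProb Q f n (z n) * ∏ j ∈ Finset.range n, (1 - acceptProb Q f j (z j))

/-- The probability of selecting the sample `z n`: the first accepted one, or `z 0` if all samples
are rejected, which makes the probabilities sum up to one for every sequence `z`. -/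
noncomputable def selectProb (Q : Measure 𝒴) (f : 𝒴 → ℝ≥0∞) (n : ℕ) (z : ℕ → 𝒴) : ℝ≥0∞ :=
  firstAcceptProb Q f n z + if n = 0 then 1 - ∑' i, firstAcceptProb Q f i z else 0

variable {Q : Measure 𝒴} {f : 𝒴 → ℝ≥0∞}

lemma acceptProb_le_one (n : ℕ) (y : 𝒴) : acceptProb Q f n y ≤ 1 :=
  ENNReal.div_le_of_le_mul (by simpa using coverPart_le_residualMass n y)

lemma measurable_acceptProb (hf : Measurable f) (n : ℕ) : Measurable (acceptProb Q f n) :=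
  (measurable_coverPart hf n).div_const _

lemma measurable_firstAcceptProb (hf : Measurable f) (n : ℕ) :
    Measurable (firstAcceptProb Q f n) := by
  have h1 := measurable_acceptProb (Q := Q) hf
  unfold firstAcceptProb
  fun_prop

lemma tsum_firstAcceptProb_le_one (z : ℕ → 𝒴) : ∑' n, firstAcceptProb Q f n z ≤ 1 := by
  have h : ∀ n, ∑ i ∈ Finset.range n, firstAcceptProb Q f i z +
      ∏ j ∈ Finset.range n, (1 - acceptProb Q f j (z j)) = 1 := by
    intro n
    induction n with
    | zero => simp
    | succ n ih =>
      rw [Finset.sum_range_succ, Finset.prod_range_succ, add_assoc, firstAcceptProb,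
        mul_comm (acceptProb _ _ _ _), ← mul_add,
        add_tsub_cancel_of_le (acceptProb_le_one n (z n)), mul_one, ih]
  exact ENNReal.tsum_le_of_sum_range_le fun n ↦ le_self_add.trans_eq (h n)

lemma tsum_selectProb (z : ℕ → 𝒴) : ∑' n, selectProb Q f n z = 1 := by
  simp_rw [selectProb]
  rw [ENNReal.tsum_add, tsum_ite_eq, add_tsub_cancel_of_le (tsum_firstAcceptProb_le_one z)]

section

variable [IsProbabilityMeasure Q] (hf : Measurable f) (hf1 : ∫⁻ y, f y ∂Q = 1)
include hf hf1

lemma prod_lintegral_reject (n : ℕ) (hn : residualMass Q f n ≠ 0) :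
    ∏ j ∈ Finset.range n, ∫⁻ y, (1 - acceptProb Q f j y) ∂Q = residualMass Q f n := by
  induction n with
  | zero => simp [residualMass_zero]
  | succ n ih =>
    have hn0 : residualMass Q f n ≠ 0 :=
      fun h ↦ hn (le_antisymm ((residualMass_anti n.le_succ).trans_eq h) bot_le)
    have hle : ∫⁻ y, acceptProb Q f n y ∂Q ≤ 1 :=
      (lintegral_mono fun y ↦ acceptProb_le_one n y).trans (by simp)
    have hmul : residualMass Q f n * ∫⁻ y, acceptProb Q f n y ∂Q =
        ∫⁻ y, coverPart Q f n y ∂Q := by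
      rw [← lintegral_const_mul _ (measurable_acceptProb hf n)]
      exact lintegral_congr fun y ↦ ENNReal.mul_div_cancel hn0 (residualMass_ne_top n)
    have hc : ∫⁻ y, coverPart Q f n y ∂Q ≠ ∞ :=
      ne_top_of_le_ne_top (residualMass_ne_top n)
        (le_add_self.trans_eq (residualMass_succ_add hf hf1 n))
    rw [Finset.prod_range_succ, ih hn0, lintegral_sub (measurable_acceptProb hf n)
        (ne_top_of_le_ne_top ENNReal.one_ne_top hle) (ae_of_all _ fun y ↦ acceptProb_le_one n y),
      ENNReal.mul_sub fun _ _ ↦ residualMass_ne_top n, hmul]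
    simp only [lintegral_const, measure_univ, mul_one]
    rw [← residualMass_succ_add hf hf1 n, ENNReal.add_sub_cancel_right hc]

/-- The sample that is accepted in step `n` has the subprobability density `coverPart Q f n`. -/
lemma lintegral_firstAcceptProb_mul {g : 𝒴 → ℝ≥0∞} (hg : Measurable g) (n : ℕ) :
    ∫⁻ z, firstAcceptProb Q f n z * g (z n) ∂(Measure.infinitePi fun _ : ℕ ↦ Q) =
      ∫⁻ y, coverPart Q f n y * g y ∂Q := by
  let h : ℕ → 𝒴 → ℝ≥0∞ := fun j y ↦
    if j = n then acceptProb Q f n y * g y else 1 - acceptProb Q f j y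
  have hm : ∀ j, Measurable (h j) := by
    intro j
    have h1 := measurable_acceptProb (Q := Q) hf
    by_cases hj : j = n
    · simp only [h, hj, if_true]
      exact (h1 n).mul hg
    · simp only [h, hj, if_false]
      exact measurable_const.sub (h1 j)
  calc ∫⁻ z, firstAcceptProb Q f n z * g (z n) ∂(Measure.infinitePi fun _ : ℕ ↦ Q)
      = ∫⁻ z, ∏ j ∈ Finset.range (n + 1), h j (z j) ∂(Measure.infinitePi fun _ : ℕ ↦ Q) := by
        refine lintegral_congr fun z ↦ ?_
        rw [Finset.prod_range_succ, firstAcceptProb]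
        have : ∏ j ∈ Finset.range n, h j (z j) =
            ∏ j ∈ Finset.range n, (1 - acceptProb Q f j (z j)) :=
          Finset.prod_congr rfl fun j hj ↦ if_neg (Finset.mem_range.1 hj).ne
        rw [this]
        simp only [h, if_true]
        ring
    _ = ∏ j ∈ Finset.range (n + 1), ∫⁻ y, h j y ∂Q := by
        rw [lintegral_prod_eq_prod_lintegral_of_indepFun (Finset.range (n + 1))
          (fun j (z : ℕ → 𝒴) ↦ h j (z j)) (iIndepFun_infinitePi hm)
          fun j ↦ (hm j).comp (measurable_pi_apply j)]
        refine Finset.prod_congr rfl fun j _ ↦ ?_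
        exact (measurePreserving_eval_infinitePi (fun _ : ℕ ↦ Q) j).lintegral_comp (hm j)
    _ = (∏ j ∈ Finset.range n, ∫⁻ y, (1 - acceptProb Q f j y) ∂Q) *
          ∫⁻ y, acceptProb Q f n y * g y ∂Q := by
        rw [Finset.prod_range_succ]
        congr 1
        · refine Finset.prod_congr rfl fun j hj ↦ ?_
          simp only [h, (Finset.mem_range.1 hj).ne, if_false]
        · simp only [h, if_true]
    _ = ∫⁻ y, coverPart Q f n y * g y ∂Q := by
        rcases eq_or_ne (residualMass Q f n) 0 with h0 | h0
        · have : ∀ y, coverPart Q f n y = 0 := fun y ↦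
            le_antisymm ((coverPart_le_residualMass n y).trans_eq h0) bot_le
          simp [acceptProb, this]
        · rw [prod_lintegral_reject hf hf1 n h0,
            ← lintegral_const_mul' _ _ (residualMass_ne_top n)]
          refine lintegral_congr fun y ↦ ?_
          rw [← mul_assoc, acceptProb, ENNReal.mul_div_cancel h0 (residualMass_ne_top n)]

/-- Almost surely some sample is accepted, so that the fallback to `z 0` plays no role. -/
lemma selectProb_ae_eq :
    ∀ᵐ z ∂(Measure.infinitePi fun _ : ℕ ↦ Q), ∀ n, selectProb Q f n z = firstAcceptProb Q f n z := by
  have hm := measurable_firstAcceptProb (Q := Q) hf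
  have h1 : ∫⁻ z, ∑' n, firstAcceptProb Q f n z ∂(Measure.infinitePi fun _ : ℕ ↦ Q) = 1 := by
    rw [lintegral_tsum fun n ↦ (hm n).aemeasurable, ← tsum_lintegral_coverPart hf hf1]
    refine tsum_congr fun n ↦ ?_
    simpa using lintegral_firstAcceptProb_mul hf hf1 (g := fun _ ↦ 1) measurable_const n
  have h0 : ∫⁻ z, (1 - ∑' n, firstAcceptProb Q f n z) ∂(Measure.infinitePi fun _ : ℕ ↦ Q) = 0 := by
    rw [lintegral_sub (Measurable.tsum hm) (h1.trans_ne ENNReal.one_ne_top)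
      (ae_of_all _ tsum_firstAcceptProb_le_one), h1]
    simp
  rw [lintegral_eq_zero_iff (by fun_prop)] at h0
  filter_upwards [h0] with z hz n
  simp only [Pi.zero_apply] at hz
  simp [selectProb, hz]

/-- Averaged over a codebook of independent samples from `Q`, the selected sample has density `f`,
and it is the sample of index `n` with the subprobability density `coverPart Q f n`. -/
lemma lintegral_selectProb_mul {g : ℕ → 𝒴 → ℝ≥0∞} (hg : ∀ n, Measurable (g n)) :
    ∫⁻ z, ∑' n, selectProb Q f n z * g n (z n) ∂(Measure.infinitePi fun _ : ℕ ↦ Q) =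
      ∑' n, ∫⁻ y, coverPart Q f n y * g n y ∂Q := by
  calc _ = ∫⁻ z, ∑' n, firstAcceptProb Q f n z * g n (z n)
        ∂(Measure.infinitePi fun _ : ℕ ↦ Q) := by
        refine lintegral_congr_ae ?_
        filter_upwards [selectProb_ae_eq hf hf1] with z hz
        simp only [hz]
    _ = _ := by
        have hm : ∀ n, Measurable fun z : ℕ → 𝒴 ↦ firstAcceptProb Q f n z * g n (z n) := fun n ↦
          (measurable_firstAcceptProb hf n).mul ((hg n).comp (measurable_pi_apply n))
        rw [lintegral_tsum fun n ↦ (hm n).aemeasurable]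
        exact tsum_congr fun n ↦ lintegral_firstAcceptProb_mul hf hf1 (hg n) n

end

section Parametric

variable {𝒳 : Type*} [MeasurableSpace 𝒳] [IsProbabilityMeasure Q] {f : 𝒳 → 𝒴 → ℝ≥0∞}
  (hf : Measurable (Function.uncurry f))
include hf

lemma measurable_coverLevel (n : ℕ) : Measurable fun x ↦ coverLevel Q (f x) n := by
  induction n with
  | zero => exact measurable_const
  | succ n ih =>
    refine ih.add (measurable_const.sub (Measurable.lintegral_prod_right'
      (f := fun p : 𝒳 × 𝒴 ↦ min (f p.1 p.2) (coverLevel Q (f p.1) n)) ?_))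
    exact hf.min (ih.comp measurable_fst)

lemma measurable_acceptProb_uncurry (n : ℕ) :
    Measurable fun p : 𝒳 × 𝒴 ↦ acceptProb Q (f p.1) n p.2 := by
  have h := measurable_coverLevel (Q := Q) hf
  have hl : ∀ n, Measurable fun p : 𝒳 × 𝒴 ↦ min (f p.1 p.2) (coverLevel Q (f p.1) n) := fun n ↦
    hf.min ((h n).comp measurable_fst)
  have hr : Measurable fun x ↦ residualMass Q (f x) n :=
    measurable_const.sub (Measurable.lintegral_prod_right' (hl n))
  exact ((hl (n + 1)).sub (hl n)).div (hr.comp measurable_fst)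

lemma measurable_selectProb (n : ℕ) :
    Measurable fun p : 𝒳 × (ℕ → 𝒴) ↦ selectProb Q (f p.1) n p.2 := by
  have h1 : ∀ n, Measurable fun p : 𝒳 × (ℕ → 𝒴) ↦ acceptProb Q (f p.1) n (p.2 n) := fun n ↦
    (measurable_acceptProb_uncurry hf n).comp
      (measurable_fst.prodMk ((measurable_pi_apply n).comp measurable_snd))
  have h2 : ∀ n, Measurable fun p : 𝒳 × (ℕ → 𝒴) ↦ firstAcceptProb Q (f p.1) n p.2 := fun n ↦
    (h1 n).mul (Finset.measurable_prod _ fun j _ ↦ measurable_const.sub (h1 j))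
  refine (h2 n).add ?_
  split_ifs
  · exact measurable_const.sub (Measurable.tsum h2)
  · exact measurable_const

lemma measurable_selectProb_mul {g : ℕ → 𝒳 → 𝒴 → ℝ≥0∞}
    (hg : ∀ n, Measurable (Function.uncurry (g n))) :
    Measurable fun p : 𝒳 × (ℕ → 𝒴) ↦ ∑' n, selectProb Q (f p.1) n p.2 * g n p.1 (p.2 n) :=
  Measurable.tsum fun n ↦ (measurable_selectProb hf n).mul ((hg n).comp
    (measurable_fst.prodMk ((measurable_pi_apply n).comp measurable_snd)))

lemma measurable_lintegral_selectProb_mul (μ : Measure 𝒳) [SFinite μ]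
    {g : ℕ → 𝒳 → 𝒴 → ℝ≥0∞} (hg : ∀ n, Measurable (Function.uncurry (g n))) :
    Measurable fun z : ℕ → 𝒴 ↦ ∫⁻ x, ∑' n, selectProb Q (f x) n z * g n x (z n) ∂μ :=
  (measurable_selectProb_mul hf hg).lintegral_prod_left'

lemma measurable_tsum_selectProb_mul {g : ℕ → 𝒳 → 𝒴 → ℝ≥0∞}
    (hg : ∀ n, Measurable (Function.uncurry (g n))) (z : ℕ → 𝒴) :
    Measurable fun x ↦ ∑' n, selectProb Q (f x) n z * g n x (z n) :=
  Measurable.of_uncurry_right (f := fun x z ↦ ∑' n, selectProb Q (f x) n z * g n x (z n))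
    (measurable_selectProb_mul hf hg)

lemma lintegral_lintegral_selectProb_mul {μ : Measure 𝒳} [IsProbabilityMeasure μ]
    (hf1 : ∀ᵐ x ∂μ, ∫⁻ y, f x y ∂Q = 1) {g : ℕ → 𝒳 → 𝒴 → ℝ≥0∞}
    (hg : ∀ n, Measurable (Function.uncurry (g n))) :
    ∫⁻ z, ∫⁻ x, ∑' n, selectProb Q (f x) n z * g n x (z n) ∂μ
        ∂(Measure.infinitePi fun _ : ℕ ↦ Q) =
      ∫⁻ x, ∑' n, ∫⁻ y, coverPart Q (f x) n y * g n x y ∂Q ∂μ := by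
  have hm := measurable_selectProb_mul (Q := Q) hf hg
  rw [← lintegral_prod_symm' _ hm, lintegral_prod _ hm.aemeasurable]
  refine lintegral_congr_ae ?_
  filter_upwards [hf1] with x hx
  exact lintegral_selectProb_mul (hf.comp measurable_prodMk_left) hx
    fun n ↦ (hg n).comp measurable_prodMk_left

end Parametric

end Sampling

/-! ### Two codebooks suffice -/

/-- If no mixture of two points of a planar family lies in the quadrant `u ≤ 0`, `v ≤ 0`, then a
line `u + σ v = 0` with `σ ≥ 0` separates the family from that quadrant. -/
lemma exists_slope_of_forall_mixture {Z : Type*} {G : Set Z} {u v : Z → ℝ}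
    (hno : ∀ z₁ ∈ G, ∀ z₂ ∈ G, ∀ t : ℝ, 0 ≤ t → t ≤ 1 →
      t * u z₁ + (1 - t) * u z₂ ≤ 0 → 0 < t * v z₁ + (1 - t) * v z₂)
    {z₀ : Z} (hz₀ : z₀ ∈ G) (hv₀ : v z₀ < 0) :
    ∃ σ : ℝ, 0 ≤ σ ∧ ∀ z ∈ G, 0 ≤ u z + σ * v z := by
  have hA : ∀ z ∈ G, u z < 0 → 0 < v z := fun z hz h ↦ by
    simpa using hno z hz z hz 1 zero_le_one le_rfl (by simpa using h.le)
  have hB : ∀ z ∈ G, v z < 0 → 0 ≤ u z := fun z hz h ↦ by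
    by_contra! h'
    exact absurd (hA z hz h') h.not_gt
  have hAB : ∀ z₁ ∈ G, ∀ z₂ ∈ G, u z₁ < 0 → v z₂ < 0 → -u z₁ / v z₁ ≤ u z₂ / -v z₂ := by
    intro z₁ h₁ z₂ h₂ hu hv
    have hv1 := hA z₁ h₁ hu
    rw [div_le_div_iff₀ hv1 (by linarith)]
    by_contra! hlt
    have hs : 0 < v z₁ - v z₂ := by linarith
    -- The weight for which the mixture of the second coordinates vanishes.
    have := hno z₁ h₁ z₂ h₂ (-v z₂ / (v z₁ - v z₂)) (div_nonneg (by linarith) hs.le)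
      ((div_le_one hs).2 (by linarith)) (by
        have : -v z₂ / (v z₁ - v z₂) * u z₁ + (1 - -v z₂ / (v z₁ - v z₂)) * u z₂ =
            (u z₂ * v z₁ - -u z₁ * -v z₂) / (v z₁ - v z₂) := by
          field_simp
          ring
        rw [this]
        exact div_nonpos_of_nonpos_of_nonneg (by linarith) hs.le)
    have h0 : -v z₂ / (v z₁ - v z₂) * v z₁ + (1 - -v z₂ / (v z₁ - v z₂)) * v z₂ = 0 := by
      field_simp
      ring
    exact this.ne' h0
  let T : Set ℝ := {s | ∃ z ∈ G, u z < 0 ∧ s = -u z / v z}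
  have hbdd : BddAbove T := ⟨u z₀ / -v z₀, by
    rintro _ ⟨z, hz, hu, rfl⟩
    exact hAB z hz z₀ hz₀ hu hv₀⟩
  have hσ : 0 ≤ sSup T := Real.sSup_nonneg (by
    rintro _ ⟨z, hz, hu, rfl⟩
    exact div_nonneg (by linarith) (hA z hz hu).le)
  refine ⟨sSup T, hσ, fun z hz ↦ ?_⟩
  rcases lt_or_ge (u z) 0 with hu | hu
  · have h := le_csSup hbdd ⟨z, hz, hu, rfl⟩
    rw [div_le_iff₀ (hA z hz hu)] at h
    linarith
  · rcases lt_or_ge (v z) 0 with hv | hv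
    · have h : sSup T ≤ u z / -v z := Real.sSup_le (by
        rintro _ ⟨z', hz', hu', rfl⟩
        exact hAB z' hz' z hz hu' hv) (div_nonneg hu (by linarith))
      rw [le_div_iff₀ (by linarith)] at h
      linarith
    · positivity

lemma exists_mixture_nonpos {Z : Type*} [MeasurableSpace Z] {P : Measure Z}
    [IsProbabilityMeasure P] {G : Set Z} (hG : ∀ᵐ z ∂P, z ∈ G) {u v : Z → ℝ}
    (hu : Integrable u P) (hv : Integrable v P) (hu0 : ∫ z, u z ∂P < 0) (hv0 : ∫ z, v z ∂P ≤ 0) :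
    ∃ z₁ ∈ G, ∃ z₂ ∈ G, ∃ t : ℝ, 0 ≤ t ∧ t ≤ 1 ∧
      t * u z₁ + (1 - t) * u z₂ ≤ 0 ∧ t * v z₁ + (1 - t) * v z₂ ≤ 0 := by
  by_contra! hno
  by_cases h : ∃ z₀ ∈ G, v z₀ < 0
  · obtain ⟨z₀, hz₀, hv₀⟩ := h
    obtain ⟨σ, hσ, hline⟩ := exists_slope_of_forall_mixture hno hz₀ hv₀
    have h1 : 0 ≤ ∫ z, (u z + σ * v z) ∂P :=
      integral_nonneg_of_ae (hG.mono fun z hz ↦ hline z hz)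
    rw [integral_add hu (hv.const_mul σ), integral_const_mul] at h1
    nlinarith [mul_nonpos_of_nonneg_of_nonpos hσ hv0]
  · push Not at h
    have hv' : 0 ≤ᵐ[P] v := hG.mono fun z hz ↦ h z hz
    have h0 := (integral_eq_zero_iff_of_nonneg_ae hv' hv).1
      (le_antisymm hv0 (integral_nonneg_of_ae hv'))
    have h1 : 0 ≤ ∫ z, u z ∂P := by
      refine integral_nonneg_of_ae ?_
      filter_upwards [hG, h0] with z hz hz0
      by_contra! hlt
      have := hno z hz z hz 1 zero_le_one le_rfl (by simpa using hlt.le)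
      simp [hz0] at this
    linarith

/-- A pair of means, the first of which is bounded strictly, is dominated by a mixture of at most
two values of the pair. -/
theorem exists_mixture_le {Z : Type*} [MeasurableSpace Z] {P : Measure Z}
    [IsProbabilityMeasure P] {u v : Z → ℝ≥0∞} (hu : Measurable u) (hv : Measurable v) {a b : ℝ≥0∞}
    (ha : a ≠ ∞) (hua : ∫⁻ z, u z ∂P < a) (hvb : ∫⁻ z, v z ∂P ≤ b) :
    ∃ z₁ z₂, ∃ t ≤ (1 : ℝ≥0∞), t * u z₁ + (1 - t) * u z₂ ≤ a ∧ t * v z₁ + (1 - t) * v z₂ ≤ b := by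
  rcases eq_or_ne b ∞ with rfl | hb
  · obtain ⟨z, hz⟩ := exists_le_lintegral hu.aemeasurable (μ := P)
    exact ⟨z, z, 1, le_rfl, by simpa using hz.trans hua.le, le_top⟩
  have hu' : ∫⁻ z, u z ∂P ≠ ∞ := hua.ne_top
  have hv' : ∫⁻ z, v z ∂P ≠ ∞ := ne_top_of_le_ne_top hb hvb
  have hui := integrable_toReal_of_lintegral_ne_top hu.aemeasurable hu'
  have hvi := integrable_toReal_of_lintegral_ne_top hv.aemeasurable hv'
  have hG : ∀ᵐ z ∂P, z ∈ {z | u z ≠ ∞ ∧ v z ≠ ∞} := by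
    filter_upwards [ae_lt_top hu hu', ae_lt_top hv hv'] with z h1 h2 using ⟨h1.ne, h2.ne⟩
  have hu0 : ∫ z, ((u z).toReal - a.toReal) ∂P < 0 := by
    rw [integral_sub hui (integrable_const _),
      integral_toReal hu.aemeasurable (ae_lt_top hu hu')]
    simpa using (ENNReal.toReal_lt_toReal hu' ha).2 hua
  have hv0 : ∫ z, ((v z).toReal - b.toReal) ∂P ≤ 0 := by
    rw [integral_sub hvi (integrable_const _),
      integral_toReal hv.aemeasurable (ae_lt_top hv hv')]
    simpa using (ENNReal.toReal_le_toReal hv' hb).2 hvb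
  obtain ⟨z₁, ⟨hu1, hv1⟩, z₂, ⟨hu2, hv2⟩, t, ht0, ht1, h1, h2⟩ :=
    exists_mixture_nonpos hG (hui.sub (integrable_const a.toReal))
      (hvi.sub (integrable_const b.toReal)) hu0 hv0
  have key : ∀ {x y c : ℝ≥0∞}, x ≠ ∞ → y ≠ ∞ → c ≠ ∞ →
      t * (x.toReal - c.toReal) + (1 - t) * (y.toReal - c.toReal) ≤ 0 →
      ENNReal.ofReal t * x + (1 - ENNReal.ofReal t) * y ≤ c := by
    intro x y c hx hy hc h
    rw [← ENNReal.ofReal_one, ← ENNReal.ofReal_sub _ ht0, ← ENNReal.ofReal_toReal hx,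
      ← ENNReal.ofReal_toReal hy, ← ENNReal.ofReal_mul ht0,
      ← ENNReal.ofReal_mul (sub_nonneg.2 ht1),
      ← ENNReal.ofReal_add (by positivity) (mul_nonneg (sub_nonneg.2 ht1) ENNReal.toReal_nonneg)]
    exact ENNReal.ofReal_le_of_le_toReal (by linarith)
  exact ⟨z₁, z₂, ENNReal.ofReal t, by simpa using ht1, key hu1 hu2 ha h1, key hv1 hv2 hb h2⟩

/-! ### The density of the joint law -/

lemma ae_lintegral_rnDeriv_eq_one {𝒳 𝒴 : Type*} [MeasurableSpace 𝒳] [MeasurableSpace 𝒴]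
    {μ : Measure 𝒳} [IsProbabilityMeasure μ] {Q : Measure 𝒴} [IsProbabilityMeasure Q]
    {κ : Kernel 𝒳 𝒴} [IsMarkovKernel κ] (hac : μ ⊗ₘ κ ≪ μ.prod Q) :
    ∀ᵐ x ∂μ, ∫⁻ y, (μ ⊗ₘ κ).rnDeriv (μ.prod Q) (x, y) ∂Q = 1 := by
  have hm : Measurable ((μ ⊗ₘ κ).rnDeriv (μ.prod Q)) := Measure.measurable_rnDeriv _ _
  refine ae_eq_of_forall_setLIntegral_eq_of_sigmaFinite hm.lintegral_prod_right' measurable_const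
    fun A hA _ ↦ ?_
  calc ∫⁻ x in A, ∫⁻ y, (μ ⊗ₘ κ).rnDeriv (μ.prod Q) (x, y) ∂Q ∂μ
      = ∫⁻ p in A ×ˢ Set.univ, (μ ⊗ₘ κ).rnDeriv (μ.prod Q) p ∂(μ.prod Q) := by
        rw [← Measure.prod_restrict, Measure.restrict_univ, lintegral_prod _ hm.aemeasurable]
    _ = (μ ⊗ₘ κ) (A ×ˢ Set.univ) := Measure.setLIntegral_rnDeriv hac _
    _ = ∫⁻ _ in A, 1 ∂μ := by
        rw [Measure.compProd_apply_prod hA MeasurableSet.univ]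
        simp

/-! ### Achievability -/

/-- With `r = ⌊log₂ m⌋` one has `r + m / 2 ^ r ≤ log₂ m + 1`, as `x - 1 ≤ log₂ x` on `[1, 2]`. -/
lemma exists_nat_add_div_pow_le {m : ℝ} (hm : 1 ≤ m) :
    ∃ r : ℕ, r + m / 2 ^ r ≤ Real.logb 2 m + 1 := by
  have h0 : 0 ≤ Real.logb 2 m := Real.logb_nonneg one_lt_two hm
  refine ⟨⌊Real.logb 2 m⌋₊, ?_⟩
  set r := ⌊Real.logb 2 m⌋₊
  have hr1 : (r : ℝ) ≤ Real.logb 2 m := Nat.floor_le h0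
  have hr2 : Real.logb 2 m < r + 1 := Nat.lt_floor_add_one _
  have hx : m / 2 ^ r = (1 + 1 : ℝ) ^ (Real.logb 2 m - r) := by
    rw [one_add_one_eq_two, Real.rpow_sub two_pos, Real.rpow_logb two_pos (by norm_num)
      (by linarith), Real.rpow_natCast]
  have := rpow_one_add_le_one_add_mul_self (s := 1) (p := Real.logb 2 m - r) (by norm_num)
    (by linarith) (by linarith)
  rw [hx]
  linarith

lemma length_golombCode_le (r n : ℕ) :
    ((golombCode r n).length + 1 : ℝ≥0∞) ≤
      ENNReal.ofReal (r + 2) +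
        ENNReal.ofReal ((1 + 1 / 2 ^ r) / Real.log 2) * ENNReal.ofReal (Real.log (n + 1)) := by
  have hl2 : 0 < Real.log 2 := Real.log_pos one_lt_two
  have hln : 0 ≤ Real.log (n + 1) := Real.log_nonneg (by simp)
  rw [← ENNReal.ofReal_mul (by positivity), ← ENNReal.ofReal_add (by positivity) (by positivity)]
  have hlog : (Nat.log 2 (n + 1) : ℝ) ≤ Real.log (n + 1) / Real.log 2 := by
    have := Real.natLog_le_logb (n + 1) 2
    rwa [Real.logb, Nat.cast_succ, Nat.cast_ofNat] at this
  have hdiv : ((Nat.log 2 (n + 1) / 2 ^ r : ℕ) : ℝ) ≤ Nat.log 2 (n + 1) / 2 ^ r := by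
    simpa using Nat.cast_div_le (α := ℝ) (m := Nat.log 2 (n + 1)) (n := 2 ^ r)
  rw [← Nat.cast_succ, ← ENNReal.ofReal_natCast]
  refine ENNReal.ofReal_le_ofReal ?_
  rw [Nat.cast_succ, length_golombCode]
  push_cast
  have h1 : (Nat.log 2 (n + 1) : ℝ) / 2 ^ r ≤ Real.log (n + 1) / Real.log 2 / 2 ^ r := by gcongr
  have h2 : (1 + 1 / 2 ^ r) / Real.log 2 * Real.log (n + 1) =
      Real.log (n + 1) / Real.log 2 + Real.log (n + 1) / Real.log 2 / 2 ^ r := by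
    field_simp
  linarith

lemma lintegral_tsum_coverPart_mul_length_le {𝒳 𝒴 : Type*} [MeasurableSpace 𝒳]
    [MeasurableSpace 𝒴] {μ : Measure 𝒳} [IsProbabilityMeasure μ] {Q : Measure 𝒴}
    [IsProbabilityMeasure Q] {f : 𝒳 → 𝒴 → ℝ≥0∞} (hf : Measurable (Function.uncurry f))
    (hf1 : ∀ᵐ x ∂μ, ∫⁻ y, f x y ∂Q = 1) {I : ℝ} (hI : 0 ≤ I)
    (hkl : ∫⁻ x, ∫⁻ y, ENNReal.ofReal (klFun (f x y).toReal) ∂Q ∂μ =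
      ENNReal.ofReal (I * Real.log 2)) (r : ℕ) :
    ∫⁻ x, ∑' n, ∫⁻ y, coverPart Q (f x) n y * ((golombCode r n).length + 1) ∂Q ∂μ ≤
      ENNReal.ofReal (r + 2 + (I + 2) + (I + 2) / 2 ^ r) := by
  have hl2 : 0 < Real.log 2 := Real.log_pos one_lt_two
  set C := (1 + 1 / 2 ^ r) / Real.log 2 with hC
  have hC0 : 0 ≤ C := by positivity
  calc _ ≤ ∫⁻ x, (ENNReal.ofReal (r + 2) + ENNReal.ofReal C *
            (∫⁻ y, ENNReal.ofReal (klFun (f x y).toReal) ∂Q +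
              ENNReal.ofReal (2 * Real.log 2))) ∂μ := by
        refine lintegral_mono_ae ?_
        filter_upwards [hf1] with x hx1
        have hx : Measurable (f x) := hf.comp measurable_prodMk_left
        calc ∑' n, ∫⁻ y, coverPart Q (f x) n y * ((golombCode r n).length + 1) ∂Q
            ≤ ∑' n, ((∫⁻ y, coverPart Q (f x) n y ∂Q) * ENNReal.ofReal (r + 2) +
                ENNReal.ofReal C * ((∫⁻ y, coverPart Q (f x) n y ∂Q) *
                  ENNReal.ofReal (Real.log (n + 1)))) := by
              refine ENNReal.tsum_le_tsum fun n ↦ ?_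
              rw [lintegral_mul_const _ (measurable_coverPart hx n), mul_left_comm, ← mul_add]
              exact mul_le_mul_right (length_golombCode_le r n) _
          _ ≤ _ := by
              rw [ENNReal.tsum_add, ENNReal.tsum_mul_right, ENNReal.tsum_mul_left,
                tsum_lintegral_coverPart hx hx1, one_mul]
              gcongr
              exact tsum_lintegral_coverPart_mul_log_le hx hx1
    _ = ENNReal.ofReal (r + 2 + C * (I * Real.log 2 + 2 * Real.log 2)) := by
        rw [lintegral_add_left measurable_const, lintegral_const_mul' _ _ ENNReal.ofReal_ne_top,
          lintegral_add_right _ measurable_const, hkl]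
        simp only [lintegral_const, measure_univ, mul_one]
        rw [← ENNReal.ofReal_add (by positivity) (by positivity), ← ENNReal.ofReal_mul hC0,
          ← ENNReal.ofReal_add (by positivity) (by positivity)]
    _ = _ := by
        congr 1
        rw [hC]
        field_simp
        ring

/-- One bit tells which of two codebooks is used, and `golombCode` describes the index of the
selected sample. -/
theorem isAchievable_of_codebooks {𝒳 𝒴 : Type*} [MeasurableSpace 𝒳] [MeasurableSpace 𝒴]
    {μ : Measure 𝒳} {d : 𝒳 → 𝒴 → ℝ≥0∞} (hd : Measurable (Function.uncurry d)) {R : ℝ} {D : ℝ≥0∞}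
    {Q : Measure 𝒴} [IsProbabilityMeasure Q] {f : 𝒳 → 𝒴 → ℝ≥0∞}
    (hf : Measurable (Function.uncurry f)) (r : ℕ) (z₁ z₂ : ℕ → 𝒴) {t : ℝ≥0∞} (ht : t ≤ 1)
    (hR : t * ∫⁻ x, ∑' n, selectProb Q (f x) n z₁ * ((golombCode r n).length + 1) ∂μ +
      (1 - t) * ∫⁻ x, ∑' n, selectProb Q (f x) n z₂ * ((golombCode r n).length + 1) ∂μ ≤
        ENNReal.ofReal R)
    (hD : t * ∫⁻ x, ∑' n, selectProb Q (f x) n z₁ * d x (z₁ n) ∂μ +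
      (1 - t) * ∫⁻ x, ∑' n, selectProb Q (f x) n z₂ * d x (z₂ n) ∂μ ≤ D) :
    IsAchievable μ d R D := by
  let zz : Bool → ℕ → 𝒴 := fun b ↦ if b then z₁ else z₂
  let wt : Bool → ℝ≥0∞ := fun b ↦ if b then t else 1 - t
  have hmix : ∀ g : ℕ → 𝒳 → 𝒴 → ℝ≥0∞, (∀ n, Measurable (Function.uncurry (g n))) →
      ∫⁻ x, ∑' i : Bool × ℕ, wt i.1 * selectProb Q (f x) i.2 (zz i.1) *
          g i.2 x (zz i.1 i.2) ∂μ =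
        t * ∫⁻ x, ∑' n, selectProb Q (f x) n z₁ * g n x (z₁ n) ∂μ +
          (1 - t) * ∫⁻ x, ∑' n, selectProb Q (f x) n z₂ * g n x (z₂ n) ∂μ := by
    intro g hg
    have hm := measurable_tsum_selectProb_mul (Q := Q) hf hg
    rw [← lintegral_const_mul _ (hm z₁), ← lintegral_const_mul _ (hm z₂),
      ← lintegral_add_left ((hm z₁).const_mul _)]
    refine lintegral_congr fun x ↦ ?_
    rw [ENNReal.tsum_prod', tsum_bool, add_comm]
    simp only [wt, zz, mul_assoc, ENNReal.tsum_mul_left]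
    simp
  have hsel : ∀ (n : ℕ) (z : ℕ → 𝒴), Measurable fun x ↦ selectProb Q (f x) n z := fun n z ↦
    Measurable.of_uncurry_right (f := fun x z ↦ selectProb Q (f x) n z) (measurable_selectProb hf n)
  refine isAchievable_of_weights (fun i : Bool × ℕ ↦ i.1 :: golombCode r i.2) ?_
    (fun i ↦ zz i.1 i.2) (fun x i ↦ wt i.1 * selectProb Q (f x) i.2 (zz i.1))
    (fun i ↦ (hsel i.2 (zz i.1)).const_mul _) (fun x ↦ ?_) ?_ ?_
  · rintro ⟨b, n⟩ ⟨b', n'⟩ h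
    obtain ⟨h1, h2⟩ := List.cons_prefix_cons.1 h
    exact Prod.ext h1 (golombCode_prefix h2)
  · rw [ENNReal.tsum_prod', tsum_bool]
    simp only [ENNReal.tsum_mul_left, tsum_selectProb, mul_one, wt]
    simpa using tsub_add_cancel_of_le ht
  · refine le_trans (le_of_eq ?_) hR
    rw [← hmix (fun n _ _ ↦ (golombCode r n).length + 1) fun n ↦ measurable_const]
    simp
  · exact (hmix (fun _ ↦ d) fun _ ↦ hd).trans_le hD

/-- Every test channel `κ` gives a code whose rate exceeds the mutual information `I` by at most
`log₂ (I + 1) + 6`. -/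
theorem isAchievable_of_kernel {𝒳 𝒴 : Type*} [MeasurableSpace 𝒳] [MeasurableSpace 𝒴]
    {μ : Measure 𝒳} [IsProbabilityMeasure μ] {d : 𝒳 → 𝒴 → ℝ≥0∞}
    (hd : Measurable (Function.uncurry d)) {R : ℝ} {D : ℝ≥0∞} (κ : Kernel 𝒳 𝒴) [IsMarkovKernel κ]
    (hD : avgDistortion μ d κ ≤ D) (hI : mutualInfoBits μ κ ≠ ∞)
    (hR : (mutualInfoBits μ κ).toReal + Real.logb 2 ((mutualInfoBits μ κ).toReal + 1) + 6 < R) :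
    IsAchievable μ d R D := by
  have hI0 : 0 ≤ (mutualInfoBits μ κ).toReal := ENNReal.toReal_nonneg
  have hkl : klDiv (μ ⊗ₘ κ) (μ.prod (κ ∘ₘ μ)) =
      ENNReal.ofReal ((mutualInfoBits μ κ).toReal * Real.log 2) := by
    rw [ENNReal.ofReal_mul hI0, ENNReal.ofReal_toReal hI, mutualInfoBits,
      ENNReal.div_mul_cancel (by simpa using Real.log_pos one_lt_two) ENNReal.ofReal_ne_top]
  set I := (mutualInfoBits μ κ).toReal
  set Q := κ ∘ₘ μ
  have hac : μ ⊗ₘ κ ≪ μ.prod Q :=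
    (klDiv_ne_top_iff.1 (hkl.trans_ne ENNReal.ofReal_ne_top)).1
  have hm : Measurable ((μ ⊗ₘ κ).rnDeriv (μ.prod Q)) := Measure.measurable_rnDeriv _ _
  let f : 𝒳 → 𝒴 → ℝ≥0∞ := fun x y ↦ (μ ⊗ₘ κ).rnDeriv (μ.prod Q) (x, y)
  have hf : Measurable (Function.uncurry f) := hm
  have hf1 : ∀ᵐ x ∂μ, ∫⁻ y, f x y ∂Q = 1 := ae_lintegral_rnDeriv_eq_one hac
  rw [klDiv_eq_lintegral_klFun_of_ac hac, lintegral_prod _ (by fun_prop)] at hkl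
  obtain ⟨r, hr⟩ := exists_nat_add_div_pow_le (m := I + 2) (by linarith)
  have hlen : ∀ n, Measurable (Function.uncurry fun (_ : 𝒳) (_ : 𝒴) ↦
      ((golombCode r n).length + 1 : ℝ≥0∞)) := fun n ↦ measurable_const
  have hu : ∫⁻ z, ∫⁻ x, ∑' n, selectProb Q (f x) n z * ((golombCode r n).length + 1) ∂μ
      ∂(Measure.infinitePi fun _ : ℕ ↦ Q) < ENNReal.ofReal R := by
    rw [lintegral_lintegral_selectProb_mul hf hf1 hlen]
    refine (lintegral_tsum_coverPart_mul_length_le hf hf1 hI0 hkl r).trans_lt ?_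
    refine (ENNReal.ofReal_lt_ofReal_iff_of_nonneg (by positivity)).2 ?_
    have h2 : Real.logb 2 (I + 2) ≤ Real.logb 2 (I + 1) + 1 := by
      have h := Real.logb_le_logb_of_le one_lt_two (by linarith : 0 < I + 2)
        (by linarith : I + 2 ≤ (I + 1) * 2)
      rwa [Real.logb_mul (by linarith) two_ne_zero, Real.logb_self_eq_one one_lt_two] at h
    linarith
  have hv : ∫⁻ z, ∫⁻ x, ∑' n, selectProb Q (f x) n z * d x (z n) ∂μ
      ∂(Measure.infinitePi fun _ : ℕ ↦ Q) ≤ D := by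
    refine le_trans ?_ hD
    have hdm : Measurable fun p : 𝒳 × 𝒴 ↦ d p.1 p.2 := hd
    rw [lintegral_lintegral_selectProb_mul hf hf1 (g := fun _ ↦ d) fun _ ↦ hd, avgDistortion,
      ← Measure.withDensity_rnDeriv_eq _ _ hac, lintegral_withDensity_eq_lintegral_mul _ hm hdm,
      lintegral_prod _ (hm.mul hdm).aemeasurable]
    refine lintegral_mono fun x ↦ ?_
    have hx : Measurable (f x) := hf.comp measurable_prodMk_left
    have hdx : Measurable (d x) := hd.comp measurable_prodMk_left
    have hcd : ∀ n, Measurable fun y ↦ coverPart Q (f x) n y * d x y := fun n ↦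
      (measurable_coverPart hx n).mul hdx
    rw [← lintegral_tsum fun n ↦ (hcd n).aemeasurable]
    refine lintegral_mono fun y ↦ ?_
    simp only [Pi.mul_apply]
    rw [ENNReal.tsum_mul_right]
    exact mul_le_mul_left (tsum_coverPart_le y) _
  obtain ⟨z₁, z₂, t, ht, htu, htv⟩ := exists_mixture_le
    (measurable_lintegral_selectProb_mul hf μ hlen)
    (measurable_lintegral_selectProb_mul hf μ (g := fun _ ↦ d) fun _ ↦ hd)
    ENNReal.ofReal_ne_top hu hv
  exact isAchievable_of_codebooks hd hf r z₁ z₂ ht htu htv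

theorem theorem2 {𝒳 𝒴 : Type*} [MeasurableSpace 𝒳] [MeasurableSpace 𝒴]
    (μ : Measure 𝒳) [IsProbabilityMeasure μ]
    (d : 𝒳 → 𝒴 → ℝ≥0∞) (hd : Measurable (Function.uncurry d))
    (R : ℝ) (D : ℝ≥0∞) (hfin : rateDistortion μ d D ≠ ∞)
    (hR : R > (rateDistortion μ d D).toReal
      + Real.logb 2 ((rateDistortion μ d D).toReal + 1) + 6) :
    IsAchievable μ d R D := by
  have h0 : 0 ≤ (rateDistortion μ d D).toReal := ENNReal.toReal_nonneg
  have hcont : ContinuousAt (fun s : ℝ ↦ s + Real.logb 2 (s + 1) + 6)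
      (rateDistortion μ d D).toReal := by
    unfold Real.logb
    have : (rateDistortion μ d D).toReal + 1 ≠ 0 := by positivity
    fun_prop (disch := assumption)
  -- By the strict inequality, some `s > R(D)` may replace `R(D)`, and a test channel has rate `< s`.
  obtain ⟨s, hs, hsR⟩ := (((hcont.eventually_lt continuousAt_const hR).filter_mono
    nhdsWithin_le_nhds).and (self_mem_nhdsWithin (s := Set.Ioi (rateDistortion μ d D).toReal))).exists
  have hlt : rateDistortion μ d D < ENNReal.ofReal s :=
    (ENNReal.lt_ofReal_iff_toReal_lt hfin).2 hsR
  simp only [rateDistortion, iInf_lt_iff] at hlt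
  obtain ⟨κ, hκ, hD, hI⟩ := hlt
  refine isAchievable_of_kernel hd κ hD hI.ne_top (lt_of_le_of_lt ?_ hs)
  have hle : (mutualInfoBits μ κ).toReal ≤ s :=
    ((ENNReal.lt_ofReal_iff_toReal_lt hI.ne_top).1 hI).le
  have h1 : Real.logb 2 ((mutualInfoBits μ κ).toReal + 1) ≤ Real.logb 2 (s + 1) :=
    Real.logb_le_logb_of_le one_lt_two (by positivity) (by linarith)
  linarith
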